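/- Let $P\subset\mathbb{R}^n$ be a convex polytope of dimension $d$ (the convex hull of finitely many points; $d$ is the dimension of its affine span). The graph $G_P$ has the vertices of $P$ as its nodes, two distinct vertices being adjacent when an edge (one-dimensional face) of $P$ contains both. A polytope $P$ is simple at a vertex $v$ if the degree of $v$ in $G_P$ equals $\dim P$. For a face $T$ of $P$, a truncation of $P$ at $T$ is a set $P'=P\cap H$, where $H$ is a closed half-space that contains no vertex of $T$ and whose interior contains every vertex of $P$ not in $T$. (1) Let $x$ be a vertex of $P$, let $T$ be a face of $P$ containing $x$, let $w$ be a vertex of $P$ adjacent to $x$ with $w\notin T$, and let $P'=P\cap H$ be any truncation of $P$ at $T$. Then $P'$ is a polytope, exactly one facet $F$ of $P'$ is contained in the boundary of $H$, and $w$ is a vertex of $P'$. There is exactly one vertex of $P'$ that lies in $F$ and on the segment $[x,w]$ and is adjacent to $w$ in $G_{P'}$. If $P$ is simple at $w$, then $P'$ is simple at that vertex and, more generally, at every vertex $v$ of $P'$ that lies in $F$ and is adjacent to $w$ in $G_{P'}$. (2) Let $d\ge 1$, let $x$ be a vertex of $P$ such that $P$ is simple at every vertex adjacent to $x$, and let $P'=P\cap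 H$ be any truncation of $P$ at $\{x\}$. Then $P'$ is a polytope, exactly one facet $F$ of $P'$ is contained in the boundary of $H$, and $P'$ is simple at every vertex of $P'$ that lies in $F$. -/

import Mathlib

namespace Polytope

variable {E : Type*} [NormedAddCommGroup E] [NormedSpace ℝ E]

/-- A (convex) polytope: the convex hull of a finite set of points. -/
def IsPolytope (P : Set E) : Prop :=
  ∃ S : Set E, S.Finite ∧ P = convexHull ℝ S

/-- The faces of `P`: the empty set, and the nonempty sets of all maximizers over `P` of a linear
functional (the zero functional gives `P` itself). -/
def IsFace (P F : Set E) : Prop :=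
  IsExposed ℝ P F

open Classical in
/-- The dimension of a convex set: the dimension of its affine span, and `-1` for the empty set. -/
noncomputable def dim (S : Set E) : ℤ :=
  if S = ∅ then -1 else (Module.finrank ℝ (vectorSpan ℝ S) : ℤ)

/-- The vertices of `P`: the points that are faces of `P`. -/
def vertices (P : Set E) : Set E :=
  {v | IsFace P {v}}

/-- Edges: faces of dimension one. -/
def IsEdge (P e : Set E) : Prop :=
  IsFace P e ∧ dim e = 1

/-- Facets: faces of dimension one less than that of `P`. -/
def IsFacet (P F : Set E) : Prop :=
  IsFace P F ∧ dim F = dim P - 1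

/-- The graph of `P`: distinct vertices are adjacent when some edge of `P` contains both. -/
def graph (P : Set E) : SimpleGraph (vertices P) where
  Adj u v := u ≠ v ∧ ∃ e, IsEdge P e ∧ (u : E) ∈ e ∧ (v : E) ∈ e
  symm := ⟨fun _ _ ⟨hne, e, he, hu, hv⟩ => ⟨hne.symm, e, he, hv, hu⟩⟩
  loopless := ⟨fun _ h => h.1 rfl⟩

/-- `P` is simple at its vertex `v` if the degree of `v` in the graph of `P` is `dim P`. -/
def SimpleAt (P : Set E) (v : vertices P) : Prop :=
  (((graph P).neighborSet v).ncard : ℤ) = dim P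

/-- Closed affine half-spaces. -/
def IsHalfspace (H : Set E) : Prop :=
  ∃ l : StrongDual ℝ E, l ≠ 0 ∧ ∃ c : ℝ, H = {y | c ≤ l y}

/-- `H` is a half-space that truncates `P` at its face `T`: it contains no vertex of `T`, and its
interior contains all vertices of `P` outside `T`. The truncated polytope is then `P ∩ H`. -/
structure IsTruncating (P T H : Set E) : Prop where
  isHalfspace : IsHalfspace H
  notMem_of_mem_vertices : ∀ u ∈ vertices T, u ∉ H
  mem_interior : ∀ u ∈ vertices P, u ∉ T → u ∈ interior H

/-- `F` is the truncation facet of `P ∩ H`: the one and only facet of `P ∩ H` that is contained in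
the boundary of the half-space `H`. -/
def IsTruncationFacet (P H F : Set E) : Prop :=
  (IsFacet (P ∩ H) F ∧ F ⊆ frontier H) ∧
    ∀ G, IsFacet (P ∩ H) G → G ⊆ frontier H → G = F

end Polytope

/-! ### Vertices as extreme points; truncations are polytopes. -/

namespace Polytope

variable {E : Type*} [NormedAddCommGroup E] [NormedSpace ℝ E]

/-! Simplicity is read off the cone of feasible directions. At a vertex this cone is pointed, and
its irredundant generators are the edge directions, so they are as many as the neighbours
(`GeneratesAt.exists_neighborSet_eq`). Conversely, a generating family with `dim P` members is
linearly independent, hence irredundant, so the vertex is simple (`GeneratesAt.simpleAt`).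

Let the hyperplane `l = c` cut an edge from `w` in direction `b i` at an interior point `v`. The new
cone at `v` is generated by `-b i` and by the projections of the other `b j` along `b i` into `ker
l` (`GeneratesAt.truncate`). Neither the number of generators nor the dimension changes, so
simplicity passes from `w` to `v` (`simpleAt_of_mem_edge`).

For a truncation at a vertex `x`, the section by the hyperplane lies in the convex hull of the
points where the edges at `x` cross it. Every new vertex is therefore such a point, and the first
part applies (`exists_adj_mem_segment`). -/

theorem interior_halfspace {l : StrongDual ℝ E} (hl : l ≠ 0) (c : ℝ) :
    interior {y | c ≤ l y} = {y | c < l y} := by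
  have h := (l.isOpenMap_of_ne_zero hl).preimage_interior_eq_interior_preimage l.continuous
    (Set.Ici c)
  rw [interior_Ici] at h
  exact h.symm

theorem frontier_halfspace {l : StrongDual ℝ E} (hl : l ≠ 0) (c : ℝ) :
    frontier {y | c ≤ l y} = {y | l y = c} := by
  have h := (l.isOpenMap_of_ne_zero hl).preimage_frontier_eq_frontier_preimage l.continuous
    (Set.Ici c)
  rw [frontier_Ici] at h
  exact h.symm

theorem IsPolytope.convex {P : Set E} (hP : IsPolytope P) : Convex ℝ P := by
  obtain ⟨S, -, rfl⟩ := hP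
  exact convex_convexHull ℝ S

theorem IsPolytope.isCompact {P : Set E} (hP : IsPolytope P) : IsCompact P := by
  obtain ⟨S, hS, rfl⟩ := hP
  exact hS.isCompact_convexHull ℝ

/-- An extreme point is outside the hull of the other points of `S`, which is closed; a functional
separating the two exposes it. -/
theorem IsPolytope.vertices_eq {P : Set E} (hP : IsPolytope P) :
    vertices P = P.extremePoints ℝ := by
  ext v
  constructor
  · intro hv
    exact isExtreme_singleton.1 (IsExposed.isExtreme hv)
  · intro hv
    obtain ⟨S, hS, rfl⟩ := hP
    have hv' : v ∉ convexHull ℝ (S \ {v}) := by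
      intro h
      have := extremePoints_convexHull_subset (inter_extremePoints_subset_extremePoints_of_subset
        (convexHull_mono Set.sdiff_subset) ⟨h, hv⟩)
      exact this.2 rfl
    obtain ⟨f, u, hfu, huv⟩ := geometric_hahn_banach_closed_point (convex_convexHull ℝ _)
      ((hS.subset Set.sdiff_subset).isClosed_convexHull ℝ) hv'
    refine mem_exposedPoints_iff_exposed_singleton.1 ⟨hv.1, f, ?_⟩
    have hsub : convexHull ℝ S ⊆ {y | f y < f v ∨ y = v} := by
      refine convexHull_min ?_ ?_
      · intro s hs
        by_cases h : s = v
        · exact Or.inr h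
        · exact Or.inl ((hfu s (subset_convexHull ℝ _ ⟨hs, h⟩)).trans huv)
      · rintro x hx y hy a b ha hb hab
        by_cases hxy : x = v ∧ y = v
        · right
          rw [hxy.1, hxy.2, ← add_smul, hab, one_smul]
        · rcases ha.eq_or_lt with rfl | ha
          · obtain rfl : b = 1 := by linarith
            simpa using hy
          rcases hb.eq_or_lt with rfl | hb
          · obtain rfl : a = 1 := by linarith
            simpa using hx
          left
          obtain rfl : b = 1 - a := by linarith
          simp only [map_add, map_smul, smul_eq_mul]
          rcases hx with hx | rfl <;> rcases hy with hy | rfl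
          · nlinarith
          · nlinarith
          · nlinarith
          · exact absurd ⟨rfl, rfl⟩ hxy
    intro y hy
    rcases hsub hy with h | rfl
    · exact ⟨h.le, fun h' => absurd h h'.not_gt⟩
    · exact ⟨le_rfl, fun _ => rfl⟩

theorem IsPolytope.finite_vertices {P : Set E} (hP : IsPolytope P) : (vertices P).Finite := by
  rw [hP.vertices_eq]
  obtain ⟨S, hS, rfl⟩ := hP
  exact hS.subset extremePoints_convexHull_subset

theorem isPolytope_of_finite_extremePoints {P : Set E} (hc : IsCompact P) (hconv : Convex ℝ P)
    (hfin : (P.extremePoints ℝ).Finite) : IsPolytope P := by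
  refine ⟨_, hfin, ?_⟩
  rw [← (hfin.isClosed_convexHull ℝ).closure_eq, closure_convexHull_extremePoints hc hconv]

theorem IsPolytope.convexHull_vertices {P : Set E} (hP : IsPolytope P) :
    convexHull ℝ (vertices P) = P := by
  rw [← (hP.finite_vertices.isClosed_convexHull ℝ).closure_eq, hP.vertices_eq,
    closure_convexHull_extremePoints hP.isCompact hP.convex]

/-- Moving a convex combination with positive weights slightly along the line through another
convex combination of the same points keeps it in the convex hull. -/
theorem exists_lineMap_mem_convexHull (t : Finset E) {w w' : E → ℝ} (hw : ∀ x ∈ t, 0 < w x)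
    (hw1 : ∑ x ∈ t, w x = 1) (hw1' : ∑ x ∈ t, w' x = 1) :
    ∃ δ > 0, ∀ ε : ℝ, |ε| ≤ δ → (∑ x ∈ t, w x • x) + ε • ((∑ x ∈ t, w' x • x) - ∑ x ∈ t, w x • x)
      ∈ convexHull ℝ (t : Set E) := by
  have key : ∀ x ∈ t, ∃ δ > 0, ∀ ε : ℝ, |ε| ≤ δ → 0 ≤ w x + ε * (w' x - w x) := by
    intro x hx
    have hpos : 0 < |w' x - w x| + 1 := by positivity
    refine ⟨w x / (|w' x - w x| + 1), div_pos (hw x hx) hpos, fun ε hε => ?_⟩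
    have h1 : |ε * (w' x - w x)| ≤ w x := by
      rw [abs_mul]
      rw [le_div_iff₀ hpos] at hε
      nlinarith [abs_nonneg ε, abs_nonneg (w' x - w x)]
    linarith [neg_abs_le (ε * (w' x - w x))]
  choose! δ hδ hδ' using key
  have hne : t.Nonempty := by
    rw [Finset.nonempty_iff_ne_empty]
    rintro rfl
    simp at hw1
  obtain ⟨x₀, hx₀, hmin⟩ := t.exists_min_image δ hne
  refine ⟨δ x₀, hδ x₀ hx₀, fun ε hε => ?_⟩
  have hsum : (∑ x ∈ t, w x • x) + ε • ((∑ x ∈ t, w' x • x) - ∑ x ∈ t, w x • x)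
      = ∑ x ∈ t, (w x + ε * (w' x - w x)) • x := by
    simp only [add_smul, mul_smul, sub_smul, Finset.sum_add_distrib, Finset.smul_sum,
      smul_sub, Finset.sum_sub_distrib]
  rw [hsum]
  refine (convex_convexHull ℝ _).sum_mem
    (fun x hx => hδ' x hx ε (hε.trans (hmin x hx))) ?_ (fun x hx => subset_convexHull ℝ _ hx)
  rw [Finset.sum_add_distrib, ← Finset.mul_sum, Finset.sum_sub_distrib, hw1, hw1']
  simp

theorem eq_of_mem_extremePoints_of_add_smul_mem {Q : Set E} {y d : E}
    (hy : y ∈ Q.extremePoints ℝ) {δ : ℝ} (hδ : 0 < δ)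
    (h : ∀ ε : ℝ, |ε| ≤ δ → y + ε • d ∈ Q) : d = 0 := by
  have h1 := h δ (abs_of_pos hδ).le
  have h2 := h (-δ) (by rw [abs_neg, abs_of_pos hδ])
  have := hy.2 h1 h2 ⟨1 / 2, 1 / 2, by norm_num, by norm_num, by norm_num, by module⟩
  have h3 : δ • d = 0 := by simpa using this
  exact (smul_eq_zero.1 h3).resolve_left hδ.ne'

/-- An extreme point `y` is determined by the support of a chosen convex representation and by
whether `l y = c`: if `z` shares both, `y` can move both ways along `z - y`. There are finitely many
such data. -/
theorem IsPolytope.inter_halfspace {P : Set E} (hP : IsPolytope P) (l : StrongDual ℝ E) (c : ℝ) :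
    IsPolytope (P ∩ {y | c ≤ l y}) := by
  classical
  have hcl : IsClosed {y | c ≤ l y} := isClosed_le continuous_const l.continuous
  refine isPolytope_of_finite_extremePoints (hP.isCompact.inter_right hcl)
    (hP.convex.inter (convex_halfSpace_ge l.toLinearMap.isLinear c)) ?_
  obtain ⟨S, hS, rfl⟩ := hP
  have hrep : ∀ y ∈ convexHull ℝ S, ∃ (t : Finset E) (w : E → ℝ), (t : Set E) ⊆ S ∧
      (∀ x ∈ t, 0 < w x) ∧ ∑ x ∈ t, w x = 1 ∧ ∑ x ∈ t, w x • x = y := by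
    intro y hy
    lift S to Finset E using hS
    rw [Finset.mem_convexHull'] at hy
    obtain ⟨w, hw0, hw1, hwy⟩ := hy
    refine ⟨S.filter (fun x => 0 < w x), w, fun x hx => (Finset.mem_filter.1 hx).1, by simp,
      ?_, ?_⟩
    · rw [← hw1]
      refine Finset.sum_filter_of_ne fun x hx h => lt_of_le_of_ne (hw0 x hx) h.symm
    · rw [← hwy]
      refine Finset.sum_filter_of_ne fun x hx h => lt_of_le_of_ne (hw0 x hx) ?_
      rintro h'
      simp [← h'] at h
  choose! t w hts hw0 hw1 hwy using hrep
  have hfin : {q : Finset E × Prop | (q.1 : Set E) ⊆ S}.Finite := by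
    have : ({q : Finset E | (q : Set E) ⊆ S} ×ˢ (Set.univ : Set Prop)).Finite :=
      Set.Finite.prod (hS.toFinset.powerset.finite_toSet.subset fun q hq => by
        simpa [← Finset.coe_subset] using hq) Set.finite_univ
    refine this.subset ?_
    rintro q hq
    exact ⟨hq, trivial⟩
  refine Set.Finite.of_injOn (f := fun y => (t y, l y = c)) (t := {q | (q.1 : Set E) ⊆ S})
    (fun y hy => hts y hy.1.1) ?_ hfin
  intro y hy z hz hyz
  simp only [Prod.mk.injEq, eq_iff_iff] at hyz
  obtain ⟨htt, hc⟩ := hyz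
  have hyP := hy.1.1
  have hzP := hz.1.1
  obtain ⟨δ, hδ, hmem⟩ := exists_lineMap_mem_convexHull (t y) (w' := w z) (hw0 y hyP) (hw1 y hyP)
    (by rw [htt]; exact hw1 z hzP)
  have hwz : ∑ x ∈ t y, w z x • x = z := by rw [htt]; exact hwy z hzP
  rw [hwz, hwy y hyP] at hmem
  have hyc : c ≤ l y := hy.1.2
  suffices ∃ δ' > 0, ∀ ε : ℝ, |ε| ≤ δ' → |ε| ≤ δ ∧ c ≤ l (y + ε • (z - y)) by
    obtain ⟨δ', hδ', h⟩ := this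
    have := eq_of_mem_extremePoints_of_add_smul_mem hy hδ'
      fun ε hε => ⟨convexHull_mono (hts y hyP) (hmem ε (h ε hε).1), (h ε hε).2⟩
    exact (sub_eq_zero.1 this).symm
  simp only [map_add, map_smul, map_sub, smul_eq_mul]
  -- On the hyperplane `z - y` is parallel to it; off the hyperplane there is slack `l y - c`.
  by_cases h : l y = c
  · refine ⟨δ, hδ, fun ε hε => ⟨hε, ?_⟩⟩
    rw [h, hc.1 h]
    simp
  · have hlt : 0 < l y - c := sub_pos.2 (lt_of_le_of_ne hyc (Ne.symm h))
    have hpos : 0 < |l z - l y| + 1 := by positivity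
    refine ⟨min δ ((l y - c) / (|l z - l y| + 1)), lt_min hδ (div_pos hlt hpos), fun ε hε => ?_⟩
    refine ⟨hε.trans (min_le_left _ _), ?_⟩
    have hε' := hε.trans (min_le_right _ _)
    rw [le_div_iff₀ hpos] at hε'
    have : |ε * (l z - l y)| ≤ l y - c := by
      rw [abs_mul]
      nlinarith [abs_nonneg ε]
    linarith [neg_abs_le (ε * (l z - l y))]

end Polytope

/-! ### Generators of the cone of feasible directions, and the graph. -/

namespace Polytope

variable {E : Type*} [NormedAddCommGroup E] [NormedSpace ℝ E]

/-- The vectors `b i` generate the cone of feasible directions of `P` at `v`. -/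
structure GeneratesAt {ι : Type*} [Fintype ι] (P : Set E) (v : E) (b : ι → E) : Prop where
  feasible : ∀ i, ∃ ε : ℝ, 0 < ε ∧ v + ε • b i ∈ P
  exists_coeff : ∀ p ∈ P, ∃ s : ι → ℝ, (∀ i, 0 ≤ s i) ∧ p - v = ∑ i, s i • b i

/-- No `b i` is a nonnegative combination of the other ones. -/
def Irredundant {ι : Type*} [Fintype ι] (b : ι → E) : Prop :=
  ∀ i, ¬ ∃ s : ι → ℝ, (∀ j, 0 ≤ s j) ∧ s i = 0 ∧ b i = ∑ j, s j • b j

variable {ι : Type*} [Fintype ι] {P : Set E} {v : E} {b : ι → E} {f : StrongDual ℝ E}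

/-- Separate the hull of the other generators from the line through `b i`. A common point has
negative `f`, hence is a positive multiple of `b i`, against irredundancy. -/
theorem Irredundant.exists_functional (hb : Irredundant b) (hf : ∀ i, f (b i) < 0) (i : ι) :
    ∃ g : StrongDual ℝ E, g (b i) = 0 ∧ ∀ j, j ≠ i → g (b j) < 0 := by
  classical
  have hK : convexHull ℝ (b '' {i}ᶜ) ⊆
      {y | f y < 0 ∧ ∃ s : ι → ℝ, (∀ j, 0 ≤ s j) ∧ s i = 0 ∧ y = ∑ j, s j • b j} := by
    refine convexHull_min ?_ ?_
    · rintro _ ⟨j, hj, rfl⟩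
      refine ⟨hf j, Pi.single j 1, ?_, ?_, ?_⟩
      · intro k
        by_cases h : k = j <;> simp [h]
      · exact Pi.single_eq_of_ne (Ne.symm hj) _
      · simp [Pi.single_apply, ite_smul]
    · rintro x ⟨hx, s, hs, hsi, rfl⟩ y ⟨hy, r, hr, hri, rfl⟩ α β hα hβ hαβ
      refine ⟨(convex_halfSpace_lt f.toLinearMap.isLinear 0) hx hy hα hβ hαβ,
        fun j => α * s j + β * r j, ?_, ?_, ?_⟩
      · intro j
        have := hs j
        have := hr j
        positivity
      · simp [hsi, hri]
      · simp only [add_smul, mul_smul, Finset.sum_add_distrib, Finset.smul_sum]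
  have hdisj : Disjoint (convexHull ℝ (b '' {i}ᶜ)) (Submodule.span ℝ {b i} : Set E) := by
    rw [Set.disjoint_left]
    intro y hy hy'
    obtain ⟨hfy, s, hs, hsi, hys⟩ := hK hy
    obtain ⟨k, rfl⟩ := Submodule.mem_span_singleton.1 hy'
    have hfi := hf i
    have hk : 0 < k := by
      rw [map_smul, smul_eq_mul] at hfy
      nlinarith
    refine hb i ⟨fun j => k⁻¹ * s j, fun j => mul_nonneg (inv_nonneg.2 hk.le) (hs j), ?_, ?_⟩
    · simp [hsi]
    · simp only [mul_smul, ← Finset.smul_sum, ← hys]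
      rw [inv_smul_smul₀ hk.ne']
  obtain ⟨g, u, w, hgu, huw, hgw⟩ := geometric_hahn_banach_compact_closed
    (convex_convexHull ℝ _) (((Set.toFinite _).image b).isCompact_convexHull ℝ)
    (Submodule.convex _) (Submodule.closed_of_finiteDimensional _) hdisj
  have hw0 : w < 0 := by simpa using hgw 0 (Submodule.zero_mem _)
  refine ⟨g, ?_, fun j hj => ?_⟩
  -- A functional bounded below on a line through 0 vanishes there; otherwise it takes the value `w`
  -- itself.
  · by_contra h
    have := hgw ((w / g (b i)) • b i) (Submodule.smul_mem _ _ (Submodule.mem_span_singleton_self _))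
    rw [map_smul, smul_eq_mul, div_mul_cancel₀ _ h] at this
    exact lt_irrefl _ this
  · exact (hgu _ (subset_convexHull ℝ _ ⟨j, hj, rfl⟩)).trans (huw.trans hw0)

theorem isFace_of_forall_le {F : Set E} (g : StrongDual ℝ E) (a : ℝ) (hle : ∀ p ∈ P, g p ≤ a)
    (hF : F = {p ∈ P | g p = a}) : IsFace P F := by
  subst hF
  rintro ⟨w, hw⟩
  refine ⟨g, ?_⟩
  ext p
  refine ⟨fun hp => ⟨hp.1, fun y hy => (hle y hy).trans hp.2.ge⟩, fun hp => ⟨hp.1, ?_⟩⟩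
  exact (hle p hp.1).antisymm (hw.2.ge.trans (hp.2 w hw.1))

theorem GeneratesAt.functional_le (h : GeneratesAt P v b) {g : StrongDual ℝ E}
    (hg : ∀ i, g (b i) ≤ 0) {p : E} (hp : p ∈ P) : g p ≤ g v := by
  obtain ⟨s, hs, hps⟩ := h.exists_coeff p hp
  have : g (p - v) ≤ 0 := by
    rw [hps, map_sum]
    refine Finset.sum_nonpos fun i _ => ?_
    rw [map_smul, smul_eq_mul]
    exact mul_nonpos_of_nonneg_of_nonpos (hs i) (hg i)
  rw [map_sub] at this
  linarith

theorem coeff_eq_zero_of_functional {g : StrongDual ℝ E} (hg : ∀ i, g (b i) ≤ 0) {s : ι → ℝ}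
    (hs : ∀ i, 0 ≤ s i) (h0 : g (∑ i, s i • b i) = 0) {i : ι} (hi : g (b i) ≠ 0) : s i = 0 := by
  rw [map_sum] at h0
  have := (Finset.sum_eq_zero_iff_of_nonpos fun i _ => by
    rw [map_smul, smul_eq_mul]
    exact mul_nonpos_of_nonneg_of_nonpos (hs i) (hg i)).1 h0 i (Finset.mem_univ i)
  rw [map_smul, smul_eq_mul] at this
  exact (mul_eq_zero.1 this).resolve_right hi

/-- The part of `P` on the ray from `v` in direction `d`. -/
def ray (P : Set E) (v d : E) : Set E := {p ∈ P | ∃ t : ℝ, 0 ≤ t ∧ p = v + t • d}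

theorem GeneratesAt.isFace_ray (h : GeneratesAt P v b) (hf : ∀ i, f (b i) < 0)
    (hb : Irredundant b) (i : ι) : IsFace P (ray P v (b i)) := by
  obtain ⟨g, hgi, hg⟩ := hb.exists_functional hf i
  have hg' : ∀ j, g (b j) ≤ 0 := fun j => by
    by_cases hj : j = i
    · rw [hj, hgi]
    · exact (hg j hj).le
  refine isFace_of_forall_le g (g v) (fun p hp => h.functional_le hg' hp) ?_
  ext p
  refine ⟨fun ⟨hp, t, ht, hpt⟩ => ⟨hp, by simp [hpt, hgi]⟩, fun ⟨hp, hpv⟩ => ⟨hp, ?_⟩⟩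
  obtain ⟨s, hs, hps⟩ := h.exists_coeff p hp
  have h0 : g (∑ i, s i • b i) = 0 := by rw [← hps, map_sub, hpv, sub_self]
  refine ⟨s i, hs i, ?_⟩
  rw [← sub_eq_iff_eq_add', hps]
  refine Finset.sum_eq_single i (fun j _ hj => ?_) (by simp)
  rw [coeff_eq_zero_of_functional hg' hs h0 (hg j hj).ne, zero_smul]

theorem dim_segment {x y : E} (h : x ≠ y) : dim (segment ℝ x y) = 1 := by
  have hne : segment ℝ x y ≠ ∅ := Set.nonempty_iff_ne_empty.1 ⟨x, left_mem_segment ℝ x y⟩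
  rw [dim, if_neg hne, vectorSpan_segment]
  rw [finrank_span_singleton (by simpa [sub_eq_zero] using h.symm)]
  rfl

theorem exists_smul_of_dim_eq_one {e : Set E} (he : dim e = 1) {x y p : E} (hx : x ∈ e)
    (hy : y ∈ e) (hxy : x ≠ y) (hp : p ∈ vectorSpan ℝ e) : ∃ k : ℝ, p = k • (y - x) := by
  have hne : e ≠ ∅ := Set.nonempty_iff_ne_empty.1 ⟨x, hx⟩
  rw [dim, if_neg hne] at he
  have h1 : Module.finrank ℝ (vectorSpan ℝ e) = 1 := by exact_mod_cast he
  have hyx : y - x ∈ vectorSpan ℝ e := vsub_mem_vectorSpan ℝ hy hx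
  obtain ⟨k, hk⟩ := (finrank_eq_one_iff_of_nonzero' (⟨y - x, hyx⟩ : vectorSpan ℝ e)
    (by simpa [Subtype.ext_iff, sub_eq_zero] using hxy.symm)).1 h1 ⟨p, hp⟩
  exact ⟨k, by simpa using (congrArg Subtype.val hk).symm⟩

/-- The far end of the ray is where `f` is least; extreme points of a face are extreme in `P`. -/
theorem GeneratesAt.exists_ray_eq_segment (h : GeneratesAt P v b) (hP : IsPolytope P) (hv : v ∈ P)
    (hf : ∀ i, f (b i) < 0) (hb : Irredundant b) (i : ι) :
    ∃ τ : ℝ, 0 < τ ∧ v + τ • b i ∈ vertices P ∧ ray P v (b i) = segment ℝ v (v + τ • b i) := by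
  have hface := h.isFace_ray hf hb i
  have hcomp : IsCompact (ray P v (b i)) := IsExposed.isCompact hface hP.isCompact
  obtain ⟨u, hu, hmin⟩ := hcomp.exists_isMinOn ⟨v, hv, 0, le_rfl, by simp⟩ f.continuous.continuousOn
  obtain ⟨huP, τ, hτ, rfl⟩ := hu
  have hfi := hf i
  have hle : ∀ t : ℝ, 0 ≤ t → v + t • b i ∈ P → t ≤ τ := by
    intro t ht htP
    have := hmin (show v + t • b i ∈ ray P v (b i) from ⟨htP, t, ht, rfl⟩)
    simp only [Set.mem_ofPred_eq, map_add, map_smul, smul_eq_mul] at this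
    nlinarith
  have hτ0 : 0 < τ := by
    obtain ⟨ε, hε, hεP⟩ := h.feasible i
    exact hε.trans_le (hle ε hε.le hεP)
  refine ⟨τ, hτ0, ?_, ?_⟩
  · rw [hP.vertices_eq]
    refine (IsExposed.isExtreme hface).extremePoints_subset_extremePoints ?_
    refine isExtreme_singleton.1 (IsExposed.isExtreme (mem_exposedPoints_iff_exposed_singleton.1
      ⟨⟨huP, τ, hτ, rfl⟩, -f, ?_⟩))
    rintro _ ⟨hyP, t, ht, rfl⟩
    have htτ := hle t ht hyP
    simp only [neg_apply, map_add, map_smul, smul_eq_mul]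
    refine ⟨by nlinarith, fun h' => ?_⟩
    have : t = τ := le_antisymm htτ (by nlinarith)
    rw [this]
  · ext p
    constructor
    · rintro ⟨hp, t, ht, rfl⟩
      have htτ := hle t ht hp
      rw [segment_eq_image']
      refine ⟨t / τ, ⟨by positivity, (div_le_one hτ0).2 htτ⟩, ?_⟩
      simp only [add_sub_cancel_left, smul_smul, div_mul_cancel₀ _ hτ0.ne']
    · intro hp
      refine ⟨hP.convex.segment_subset hv huP hp, ?_⟩
      rw [segment_eq_image'] at hp
      obtain ⟨θ, hθ, rfl⟩ := hp
      exact ⟨θ * τ, mul_nonneg hθ.1 hτ, by simp [smul_smul]⟩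

/-- Every edge through `v` points in one of the generating directions. -/
theorem GeneratesAt.exists_of_isEdge (h : GeneratesAt P v b) (hf : ∀ i, f (b i) < 0) {e : Set E}
    (he : IsEdge P e) (hv : v ∈ e) {u : E} (hu : u ∈ e) (hvu : v ≠ u) :
    ∃ i, ∃ t : ℝ, 0 < t ∧ u = v + t • b i := by
  obtain ⟨hface, hdim⟩ := he
  obtain ⟨m, rfl⟩ := hface ⟨v, hv⟩
  have hm : ∀ i, m (b i) ≤ 0 := by
    intro i
    obtain ⟨ε, hε, hεP⟩ := h.feasible i
    have := hv.2 _ hεP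
    simp only [map_add, map_smul, smul_eq_mul] at this
    nlinarith
  obtain ⟨s, hs, hus⟩ := h.exists_coeff u hu.1
  have h0 : m (∑ i, s i • b i) = 0 := by
    rw [← hus, map_sub, sub_eq_zero]
    exact (hv.2 u hu.1).antisymm (hu.2 v hv.1)
  -- A generator used by `u - v` lies in the kernel of `m`, so a short step along it stays in the
  -- edge and is parallel to `u - v`; the sign of `f` then makes the factor positive.
  have hex : ∃ i, s i ≠ 0 := by
    by_contra! hall
    apply hvu
    rw [eq_comm, ← sub_eq_zero, hus]
    simp [hall]
  obtain ⟨i, hi⟩ := hex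
  have hmi : m (b i) = 0 := by
    by_contra hne
    exact hi (coeff_eq_zero_of_functional hm hs h0 hne)
  obtain ⟨ε, hε, hεP⟩ := h.feasible i
  have hmem : v + ε • b i ∈ {x ∈ P | ∀ y ∈ P, m y ≤ m x} :=
    ⟨hεP, fun y hy => by simpa [hmi] using hv.2 y hy⟩
  obtain ⟨k, hk⟩ := exists_smul_of_dim_eq_one (p := ε • b i) hdim hv hu hvu
    (by simpa using vsub_mem_vectorSpan ℝ hmem hv)
  have hfu : f (u - v) < 0 := by
    rw [hus, map_sum]
    refine Finset.sum_neg' (fun j _ => ?_) ⟨i, Finset.mem_univ i, ?_⟩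
    · rw [map_smul, smul_eq_mul]
      exact mul_nonpos_of_nonneg_of_nonpos (hs j) (hf j).le
    · rw [map_smul, smul_eq_mul]
      exact mul_neg_of_pos_of_neg (lt_of_le_of_ne (hs i) hi.symm) (hf i)
  have hk0 : 0 < k := by
    have := congrArg f hk
    rw [map_smul, map_smul, smul_eq_mul, smul_eq_mul] at this
    have hfi := hf i
    by_contra! hk'
    nlinarith [mul_nonneg_of_nonpos_of_nonpos hk' hfu.le, mul_neg_of_pos_of_neg hε hfi]
  refine ⟨i, k⁻¹ * ε, by positivity, ?_⟩
  rw [mul_smul, hk, inv_smul_smul₀ hk0.ne', add_sub_cancel]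

/-- The neighbours of `v` in the graph of `P` correspond to the irredundant generators of the cone
of feasible directions at `v`. -/
theorem GeneratesAt.exists_neighborSet_eq (h : GeneratesAt P v b) (hP : IsPolytope P)
    (hv : v ∈ vertices P) (hf : ∀ i, f (b i) < 0) (hb : Irredundant b) :
    ∃ (u : ι → vertices P) (τ : ι → ℝ), Function.Injective u ∧
      (∀ i, 0 < τ i ∧ (u i : E) = v + τ i • b i) ∧
      (graph P).neighborSet ⟨v, hv⟩ = Set.range u := by
  classical
  have hvP : v ∈ P := IsExposed.subset hv rfl
  choose τ hτ hτv hseg using h.exists_ray_eq_segment hP hvP hf hb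
  have hne : ∀ i, v ≠ v + τ i • b i := by
    intro i hi
    have := congrArg f hi
    have hfi := hf i
    have hτi := hτ i
    simp only [map_add, map_smul, smul_eq_mul] at this
    nlinarith [mul_neg_of_pos_of_neg hτi hfi]
  refine ⟨fun i => ⟨_, hτv i⟩, τ, ?_, fun i => ⟨hτ i, rfl⟩, ?_⟩
  · intro i j hij
    by_contra hne'
    have hij' : τ i • b i = τ j • b j := add_left_cancel (congrArg Subtype.val hij)
    refine hb i ⟨Pi.single j ((τ i)⁻¹ * τ j), ?_, ?_, ?_⟩
    · intro k
      have := hτ i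
      have := hτ j
      by_cases hk : k = j
      · rw [hk, Pi.single_eq_same]
        positivity
      · rw [Pi.single_eq_of_ne hk]
    · exact Pi.single_eq_of_ne hne' _
    · rw [Finset.sum_eq_single j (fun k _ hk => by simp [hk]) (by simp), Pi.single_eq_same,
        mul_smul, ← hij', inv_smul_smul₀ (hτ i).ne']
  · ext ⟨u, hu⟩
    simp only [SimpleGraph.mem_neighborSet, Set.mem_range, Subtype.mk.injEq]
    constructor
    · rintro ⟨hvu, e, he, hve, hue⟩
      have hvu' : v ≠ u := fun h' => hvu (Subtype.ext h')
      obtain ⟨i, t, ht, rfl⟩ := h.exists_of_isEdge hf he hve hue hvu'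
      refine ⟨i, ?_⟩
      have hray : v + t • b i ∈ segment ℝ v (v + τ i • b i) :=
        hseg i ▸ ⟨IsExposed.subset hu rfl, t, ht.le, rfl⟩
      have hu' := hP.vertices_eq ▸ hu
      rcases (mem_extremePoints_iff_forall_segment.1 hu').2 v hvP _
        (IsExposed.subset (hτv i) rfl) hray with h' | h'
      · exact absurd h' hvu'
      · exact h'
    · rintro ⟨i, rfl⟩
      refine ⟨fun h' => hne i (congrArg Subtype.val h'), ray P v (b i),
        ⟨h.isFace_ray hf hb i, ?_⟩, ?_, ?_⟩
      · rw [hseg i]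
        exact dim_segment (hne i)
      · rw [hseg i]
        exact left_mem_segment ℝ _ _
      · rw [hseg i]
        exact right_mem_segment ℝ _ _

end Polytope

/-! ### A criterion for simplicity, and the cone after a cut. -/

namespace Polytope

variable {E : Type*} [NormedAddCommGroup E] [NormedSpace ℝ E]
variable {ι : Type*} {P : Set E} {v : E} {b : ι → E}

/-- The cone of feasible directions at a vertex of a polytope has a finite irredundant family of
generators on which some functional is negative. -/
theorem IsPolytope.exists_generatesAt (hP : IsPolytope P) (hv : v ∈ vertices P) :
    ∃ (B : Finset E) (f : StrongDual ℝ E), GeneratesAt P v (fun u : B => (u : E) - v) ∧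
      (∀ u : B, f ((u : E) - v) < 0) ∧ Irredundant (fun u : B => (u : E) - v) := by
  classical
  let V := hP.finite_vertices.toFinset
  have hVP : ∀ u ∈ V, u ∈ P := fun u hu =>
    IsExposed.subset (hP.finite_vertices.mem_toFinset.1 hu) rfl
  -- An inclusion-minimal set of vertices with this property gives irredundant generators.
  let Q : Finset E → Prop := fun B => B ⊆ V.erase v ∧ ∀ p ∈ P, ∃ s : E → ℝ, (∀ x, 0 ≤ s x) ∧
    p - v = ∑ x ∈ B, s x • (x - v)
  have hQ : Q (V.erase v) := by
    refine ⟨subset_rfl, fun p hp => ?_⟩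
    rw [← hP.convexHull_vertices, ← hP.finite_vertices.coe_toFinset, Finset.mem_convexHull'] at hp
    obtain ⟨r, hr0, hr1, hrp⟩ := hp
    -- The weights `r` are known to be nonnegative only on `V`, while `Q` asks for it everywhere.
    refine ⟨fun x => |r x|, fun x => abs_nonneg _, ?_⟩
    rw [Finset.sum_erase _ (by simp)]
    have h1 : ∑ x ∈ V, |r x| • (x - v) = ∑ x ∈ V, r x • (x - v) :=
      Finset.sum_congr rfl fun x hx => by rw [abs_of_nonneg (hr0 x hx)]
    rw [h1]
    simp only [smul_sub, Finset.sum_sub_distrib, ← Finset.sum_smul]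
    rw [hrp, hr1, one_smul]
  obtain ⟨B, -, hB⟩ := exists_minimal_le_of_wellFoundedLT Q _ hQ
  obtain ⟨-, f, hf⟩ := mem_exposedPoints_iff_exposed_singleton.2 hv
  have hBV : ∀ u ∈ B, u ∈ V ∧ u ≠ v := fun u hu => by
    have := hB.prop.1 hu
    rw [Finset.mem_erase] at this
    exact this.symm
  refine ⟨B, f, ⟨fun u => ⟨1, one_pos, ?_⟩, fun p hp => ?_⟩, fun u => ?_, ?_⟩
  · rw [one_smul, add_sub_cancel]
    exact hVP _ (hBV _ u.2).1
  · obtain ⟨s, hs, hps⟩ := hB.prop.2 p hp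
    refine ⟨fun u => s u, fun u => hs u, ?_⟩
    rw [hps]
    exact (Finset.sum_coe_sort B fun x => s x • (x - v)).symm
  · rw [map_sub, sub_neg]
    obtain ⟨h1, h2⟩ := hf u (hVP _ (hBV _ u.2).1)
    exact lt_of_le_of_ne h1 fun h => (hBV _ u.2).2 (h2 h.ge)
  · rintro i ⟨s, hs, hsi, hi⟩
    let s' : E → ℝ := fun x => if h : x ∈ B then s ⟨x, h⟩ else 0
    have hs' : ∀ x, 0 ≤ s' x := fun x => by
      by_cases h : x ∈ B
      · simp only [s', dif_pos h, hs]
      · simp only [s', dif_neg h, le_rfl]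
    have hsi' : s' i = 0 := by simp only [s', dif_pos i.2, hsi]
    have hi' : (i : E) - v = ∑ x ∈ B, s' x • (x - v) := by
      refine hi.trans ?_
      rw [← Finset.sum_coe_sort B fun x => s' x • (x - v)]
      exact Finset.sum_congr rfl fun u _ => by simp only [s', dif_pos u.2]
    have hE : Q (B.erase i) := by
      refine ⟨(Finset.erase_subset _ _).trans hB.prop.1, fun p hp => ?_⟩
      obtain ⟨r, hr, hpr⟩ := hB.prop.2 p hp
      -- Substitute the relation for `i - v`; over all of `B` this adds `r i • (i - v)`, which is
      -- exactly the term removed with `i`.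
      refine ⟨fun x => r x + r i * s' x, fun x => add_nonneg (hr x) (mul_nonneg (hr i) (hs' x)), ?_⟩
      have h1 := Finset.add_sum_erase B (fun x => (r x + r i * s' x) • (x - v)) i.2
      simp only [hsi', mul_zero, add_zero] at h1
      have h2 : ∑ x ∈ B, (r x + r i * s' x) • (x - v) = (p - v) + r i • ((i : E) - v) := by
        simp only [add_smul, mul_smul, Finset.sum_add_distrib, ← Finset.smul_sum]
        rw [← hpr, ← hi']
      rw [h2, add_comm] at h1
      exact (add_right_cancel h1).symm
    exact Finset.notMem_erase (i : E) B (hB.le_of_le hE (Finset.erase_subset _ _) i.2)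

/-- The generators span a space containing the direction space of `P`, and there are only `dim P` of
them. -/
theorem GeneratesAt.linearIndependent [Fintype ι] (h : GeneratesAt P v b) (hv : v ∈ P)
    (hcard : (Fintype.card ι : ℤ) = dim P) : LinearIndependent ℝ b := by
  have hne : P ≠ ∅ := Set.nonempty_iff_ne_empty.1 ⟨v, hv⟩
  rw [dim, if_neg hne] at hcard
  have hcard' : Fintype.card ι = Module.finrank ℝ (vectorSpan ℝ P) := by exact_mod_cast hcard
  rw [linearIndependent_iff_card_eq_finrank_span]
  refine le_antisymm ?_ (finrank_range_le_card b)
  rw [hcard']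
  have : FiniteDimensional ℝ (Submodule.span ℝ (Set.range b)) :=
    FiniteDimensional.span_of_finite ℝ (Set.finite_range b)
  refine Submodule.finrank_mono ?_
  rw [vectorSpan_eq_span_vsub_set_right ℝ hv, Submodule.span_le]
  rintro _ ⟨p, hp, rfl⟩
  obtain ⟨s, -, hps⟩ := h.exists_coeff p hp
  change p - v ∈ _
  rw [hps]
  exact Submodule.sum_mem _ fun i _ => Submodule.smul_mem _ _ (Submodule.subset_span ⟨i, rfl⟩)

theorem irredundant_of_linearIndependent [Fintype ι] (hb : LinearIndependent ℝ b) : Irredundant b := by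
  classical
  rintro i ⟨s, -, hsi, hi⟩
  have h0 : ∑ j, (s j - (Pi.single i 1 : ι → ℝ) j) • b j = 0 := by
    simp only [sub_smul, Finset.sum_sub_distrib, ← hi]
    simp [Pi.single_apply, ite_smul]
  have := Fintype.linearIndependent_iff.1 hb _ h0 i
  simp [hsi] at this

theorem exists_functional_neg_of_linearIndependent [FiniteDimensional ℝ E]
    (hb : LinearIndependent ℝ b) : ∃ f : StrongDual ℝ E, ∀ i, f (b i) < 0 := by
  obtain ⟨g, hg⟩ := LinearMap.exists_extend
    ((Module.Basis.span hb).constr ℝ (fun _ => (-1 : ℝ)))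
  refine ⟨g.toContinuousLinearMap, fun i => ?_⟩
  have h1 := LinearMap.congr_fun hg (Module.Basis.span hb i)
  rw [Module.Basis.constr_basis] at h1
  simp only [LinearMap.comp_apply, Submodule.subtype_apply, Module.Basis.span_apply] at h1
  simp [h1]

theorem ncard_range_of_injective {α β : Type*} [Fintype α] {u : α → β}
    (hu : Function.Injective u) : (Set.range u).ncard = Fintype.card α := by
  rw [← Set.image_univ, Set.ncard_image_of_injective _ hu, Set.ncard_univ,
    Nat.card_eq_fintype_card]

theorem GeneratesAt.simpleAt [FiniteDimensional ℝ E] [Fintype ι] (h : GeneratesAt P v b) (hP : IsPolytope P)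
    (hv : v ∈ vertices P) (hcard : (Fintype.card ι : ℤ) = dim P) : SimpleAt P ⟨v, hv⟩ := by
  have hb := h.linearIndependent (IsExposed.subset hv rfl) hcard
  obtain ⟨f, hf⟩ := exists_functional_neg_of_linearIndependent hb
  obtain ⟨u, τ, hu, -, hN⟩ := h.exists_neighborSet_eq hP hv hf (irredundant_of_linearIndependent hb)
  rw [SimpleAt, hN, ncard_range_of_injective hu, hcard]

theorem exists_feasible_add (hP : Convex ℝ P) {d₁ d₂ : E} (h₁ : ∃ ε : ℝ, 0 < ε ∧ v + ε • d₁ ∈ P)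
    (h₂ : ∃ ε : ℝ, 0 < ε ∧ v + ε • d₂ ∈ P) : ∃ ε : ℝ, 0 < ε ∧ v + ε • (d₁ + d₂) ∈ P := by
  obtain ⟨α, hα, h₁⟩ := h₁
  obtain ⟨β, hβ, h₂⟩ := h₂
  -- The weights `β / (α + β)` and `α / (α + β)` turn the steps `α` and `β` into a common one.
  refine ⟨α * β / (α + β), by positivity, ?_⟩
  have := hP h₁ h₂ (a := β / (α + β)) (b := α / (α + β)) (by positivity) (by positivity)
    (by field_simp; ring)
  convert this using 1
  match_scalars <;> (field_simp; try ring)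

theorem exists_feasible_smul {d : E} (h : ∃ ε : ℝ, 0 < ε ∧ v + ε • d ∈ P) {k : ℝ} (hk : 0 < k) :
    ∃ ε : ℝ, 0 < ε ∧ v + ε • (k • d) ∈ P := by
  obtain ⟨ε, hε, h⟩ := h
  refine ⟨ε / k, by positivity, ?_⟩
  rwa [smul_smul, div_mul_cancel₀ _ hk.ne']

open Classical in
/-- Cutting a polytope in a relative interior point of an edge: generators of the cone of feasible
directions at the new point, from those at an end of the edge. -/
theorem GeneratesAt.truncate [Fintype ι] {w : E} (h : GeneratesAt P w b) (hP : Convex ℝ P) (hw : w ∈ P)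
    {l : StrongDual ℝ E} {i : ι} (hli : l (b i) < 0) {t t' : ℝ} (ht : 0 < t) (htt' : t < t')
    (ht' : w + t' • b i ∈ P) :
    GeneratesAt (P ∩ {y | l (w + t • b i) ≤ l y}) (w + t • b i)
      (fun j => if j = i then -b i else b j - (l (b j) / l (b i)) • b i) := by
  set v := w + t • b i with hv
  have hvP : v ∈ P := by
    have := hP hw ht' (a := (t' - t) / t') (b := t / t')
      (div_nonneg (by linarith) (by linarith)) (div_nonneg ht.le (by linarith))
      (by rw [← add_div, sub_add_cancel, div_self (by linarith)])
    convert this using 1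
    have : t' ≠ 0 := by linarith
    rw [hv]
    match_scalars <;> field_simp
    ring
  have hpos : ∃ ε : ℝ, 0 < ε ∧ v + ε • b i ∈ P := by
    refine ⟨t' - t, by linarith, ?_⟩
    convert ht' using 1
    rw [hv]
    module
  have hneg : ∃ ε : ℝ, 0 < ε ∧ v + ε • (-b i) ∈ P := by
    refine ⟨t, ht, ?_⟩
    rw [hv, smul_neg, add_neg_cancel_right]
    exact hw
  have hall : ∀ k : ℝ, ∃ ε : ℝ, 0 < ε ∧ v + ε • (k • b i) ∈ P := by
    intro k
    rcases lt_trichotomy k 0 with hk | rfl | hk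
    · have := exists_feasible_smul hneg (neg_pos.2 hk)
      rwa [neg_smul_neg] at this
    · exact ⟨1, one_pos, by simpa using hvP⟩
    · exact exists_feasible_smul hpos hk
  -- The vector `δ • b j - t • b i` leads from `v` to a point of `P`, and adding `t • b i` keeps it
  -- feasible.
  have hbj : ∀ j, ∃ ε : ℝ, 0 < ε ∧ v + ε • b j ∈ P := by
    intro j
    obtain ⟨δ, hδ, hj⟩ := h.feasible j
    have h1 : ∃ ε : ℝ, 0 < ε ∧ v + ε • (δ • b j - t • b i) ∈ P := by
      refine ⟨1, one_pos, ?_⟩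
      convert hj using 1
      rw [hv]
      module
    have h2 := exists_feasible_smul (exists_feasible_add hP h1 (hall t)) (inv_pos.2 hδ)
    rwa [sub_add_cancel, inv_smul_smul₀ hδ.ne'] at h2
  refine ⟨fun j => ?_, fun p hp => ?_⟩
  · by_cases hj : j = i
    · obtain ⟨ε, hε, hmem⟩ := hneg
      simp only [if_pos hj]
      refine ⟨ε, hε, hmem, ?_⟩
      simp only [Set.mem_ofPred_eq, map_add, map_smul, map_neg, smul_eq_mul]
      nlinarith
    · obtain ⟨ε, hε, hmem⟩ := exists_feasible_add hP (hbj j) (hall (-(l (b j) / l (b i))))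
      simp only [if_neg hj]
      rw [neg_smul, ← sub_eq_add_neg] at hmem
      refine ⟨ε, hε, hmem, ?_⟩
      simp only [Set.mem_ofPred_eq, map_add, map_smul, map_sub, smul_eq_mul]
      rw [div_mul_cancel₀ _ hli.ne]
      linarith
  · obtain ⟨s, hs, hps⟩ := h.exists_coeff p hp.1
    -- The other new generators lie in `ker l`, so applying `l` forces this coefficient of `-b i`.
    let r : ℝ := -(l (p - v) / l (b i))
    have hr : 0 ≤ r := by
      have : 0 ≤ l (p - v) := by
        rw [map_sub, sub_nonneg]
        exact hp.2
      exact neg_nonneg.2 (div_nonpos_of_nonneg_of_nonpos this hli.le)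
    have hpv : p - v = ∑ j, s j • b j - t • b i := by
      rw [← hps, hv]
      abel
    refine ⟨fun j => if j = i then r else s j, fun j => ?_, ?_⟩
    · dsimp only
      split_ifs
      · exact hr
      · exact hs j
    · rw [← Finset.add_sum_erase _ _ (Finset.mem_univ i)]
      have hsum : ∑ j ∈ Finset.univ.erase i, (if j = i then r else s j) •
          (if j = i then -b i else b j - (l (b j) / l (b i)) • b i) =
          ∑ j ∈ Finset.univ.erase i, s j • (b j - (l (b j) / l (b i)) • b i) :=
        Finset.sum_congr rfl fun j hj => by
          rw [if_neg (Finset.ne_of_mem_erase hj), if_neg (Finset.ne_of_mem_erase hj)]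
      simp only [if_true]
      rw [hsum]
      rw [← Finset.add_sum_erase _ _ (Finset.mem_univ i)] at hpv
      have hlr : r * l (b i) =
          -(s i * l (b i) + ∑ j ∈ Finset.univ.erase i, s j * l (b j) - t * l (b i)) := by
        have := congrArg l hpv
        simp only [map_sub l (_ + _), map_add, map_sum, map_smul, smul_eq_mul] at this
        rw [← this]
        rw [neg_mul, div_mul_cancel₀ _ hli.ne]
      have hr' : r = -(s i + (∑ j ∈ Finset.univ.erase i, s j * (l (b j) / l (b i))) - t) := by
        have hne := hli.ne
        apply mul_right_cancel₀ hne
        rw [hlr]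
        simp only [neg_mul, sub_mul, add_mul, Finset.sum_mul]
        congr 4
        funext j
        rw [mul_assoc, div_mul_cancel₀ _ hne]
      rw [hpv, hr']
      simp only [smul_sub, Finset.sum_sub_distrib, smul_smul, ← Finset.sum_smul]
      module

end Polytope

/-! ### Dimension, truncation facet and edges of the truncated polytope. -/

namespace Polytope

variable {E : Type*} [NormedAddCommGroup E] [NormedSpace ℝ E]
variable {P : Set E} {l : StrongDual ℝ E} {c : ℝ}

/-- A short step from `w` towards any point of `C` stays in the half-space. -/
theorem vectorSpan_inter_halfspace {C : Set E} (hC : Convex ℝ C) {w : E} (hw : w ∈ C)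
    (hlw : c < l w) : vectorSpan ℝ (C ∩ {y | c ≤ l y}) = vectorSpan ℝ C := by
  refine le_antisymm (vectorSpan_mono ℝ Set.inter_subset_left) ?_
  rw [vectorSpan_eq_span_vsub_set_right ℝ hw, Submodule.span_le]
  rintro _ ⟨p, hp, rfl⟩
  have hpos : 0 < |l (p - w)| + 1 := by positivity
  have hε : 0 < min 1 ((l w - c) / (|l (p - w)| + 1)) :=
    lt_min one_pos (div_pos (sub_pos.2 hlw) hpos)
  set ε := min 1 ((l w - c) / (|l (p - w)| + 1))
  have hε1 : ε ≤ 1 := min_le_left _ _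
  have hε2 : ε * (|l (p - w)| + 1) ≤ l w - c := (le_div_iff₀ hpos).1 (min_le_right _ _)
  have hmem : w + ε • (p - w) ∈ C ∩ {y | c ≤ l y} := by
    refine ⟨hC.add_smul_sub_mem hw hp ⟨hε.le, hε1⟩, ?_⟩
    simp only [Set.mem_ofPred_eq, map_add, map_smul, smul_eq_mul]
    nlinarith [neg_abs_le (l (p - w))]
  have h1 := vsub_mem_vectorSpan ℝ hmem (show w ∈ C ∩ {y | c ≤ l y} from ⟨hw, hlw.le⟩)
  rw [vsub_eq_sub, add_sub_cancel_left] at h1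
  have h2 := Submodule.smul_mem _ ε⁻¹ h1
  rwa [inv_smul_smul₀ hε.ne'] at h2

theorem dim_inter_halfspace {C : Set E} (hC : Convex ℝ C) {w : E} (hw : w ∈ C)
    (hlw : c < l w) : dim (C ∩ {y | c ≤ l y}) = dim C := by
  have h1 : C ≠ ∅ := Set.nonempty_iff_ne_empty.1 ⟨w, hw⟩
  have h2 : C ∩ {y | c ≤ l y} ≠ ∅ := Set.nonempty_iff_ne_empty.1 ⟨w, hw, hlw.le⟩
  rw [dim, dim, if_neg h1, if_neg h2, vectorSpan_inter_halfspace hC hw hlw]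

theorem exists_mem_segment_of_lt {x w : E} (hx : l x < c) (hw : c < l w) :
    ∃ q ∈ segment ℝ x w, l q = c := by
  have hpos : 0 < l w - l x := by linarith
  refine ⟨x + ((c - l x) / (l w - l x)) • (w - x), ?_, ?_⟩
  · rw [segment_eq_image']
    exact ⟨_, ⟨div_nonneg (by linarith) hpos.le, (div_le_one hpos).2 (by linarith)⟩, rfl⟩
  · simp only [map_add, map_smul, map_sub, smul_eq_mul]
    field_simp
    ring

theorem eq_of_mem_segment {x w q r : E} (hxw : l x ≠ l w) (hq : q ∈ segment ℝ x w)
    (hr : r ∈ segment ℝ x w) (h : l q = l r) : q = r := by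
  rw [segment_eq_image'] at hq hr
  obtain ⟨s, -, rfl⟩ := hq
  obtain ⟨t, -, rfl⟩ := hr
  simp only [map_add, map_smul, map_sub, smul_eq_mul, add_right_inj] at h
  rw [mul_right_cancel₀ (sub_ne_zero.2 hxw.symm) h]

/-- Let `π` project onto `ker l` along `w - x`. Moving `p` towards `x` or `w` until it meets the
hyperplane scales `π (p - q)` by `1 - θ > 0`, so `π` maps the whole span into that of the section.
-/
theorem vectorSpan_inter_hyperplane {C : Set E} (hC : Convex ℝ C) {x w : E} (hx : x ∈ C)
    (hw : w ∈ C) (hlx : l x < c) (hlw : c < l w) :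
    vectorSpan ℝ (C ∩ {y | l y = c}) = vectorSpan ℝ C ⊓ l.toLinearMap.ker := by
  have hpos : 0 < l (w - x) := by rw [map_sub]; linarith
  obtain ⟨q, hq, hlq⟩ := exists_mem_segment_of_lt hlx hlw
  have hqC : q ∈ C := hC.segment_subset hx hw hq
  refine le_antisymm (le_inf (vectorSpan_mono ℝ Set.inter_subset_left) ?_) ?_
  · rw [vectorSpan_eq_span_vsub_set_right ℝ (show q ∈ C ∩ {y | l y = c} from ⟨hqC, hlq⟩),
      Submodule.span_le]
    rintro _ ⟨p, hp, rfl⟩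
    have : l p = c := hp.2
    simp [this, hlq]
  · let π : E →ₗ[ℝ] E := LinearMap.id - (l.toLinearMap.smulRight ((l (w - x))⁻¹ • (w - x)))
    have hπ : ∀ d, π d = d - l d • ((l (w - x))⁻¹ • (w - x)) := fun d => rfl
    have hπker : ∀ d, l d = 0 → π d = d := fun d hd => by rw [hπ, hd, zero_smul, sub_zero]
    have hπwx : π (w - x) = 0 := by
      rw [hπ, smul_inv_smul₀ hpos.ne', sub_self]
    have hπseg : ∀ r ∈ segment ℝ x w, π (r - q) = 0 := by
      intro r hr
      rw [segment_eq_image'] at hq hr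
      obtain ⟨s, -, rfl⟩ := hq
      obtain ⟨t, -, rfl⟩ := hr
      have : x + t • (w - x) - (x + s • (w - x)) = (t - s) • (w - x) := by module
      rw [this, map_smul, hπwx, smul_zero]
    have hmain : ∀ p ∈ C, π (p - q) ∈ vectorSpan ℝ (C ∩ {y | l y = c}) := by
      intro p hp
      obtain ⟨a, ha, θ, hθ0, hθ1, hlr, haC⟩ : ∃ a ∈ segment ℝ x w, ∃ θ : ℝ, 0 ≤ θ ∧ θ < 1 ∧
          l (p + θ • (a - p)) = c ∧ a ∈ C := by
        rcases lt_trichotomy (l p) c with h | h | h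
        · refine ⟨w, right_mem_segment ℝ _ _, (c - l p) / (l w - l p),
            div_nonneg (by linarith) (by linarith), (div_lt_one (by linarith)).2 (by linarith),
            ?_, hw⟩
          have : l w - l p ≠ 0 := by linarith
          simp only [map_add, map_smul, map_sub, smul_eq_mul]
          field_simp
          ring
        · exact ⟨w, right_mem_segment ℝ _ _, 0, le_rfl, one_pos, by simp [h], hw⟩
        · refine ⟨x, left_mem_segment ℝ _ _, (l p - c) / (l p - l x),
            div_nonneg (by linarith) (by linarith), (div_lt_one (by linarith)).2 (by linarith),
            ?_, hx⟩
          have : l p - l x ≠ 0 := by linarith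
          simp only [map_add, map_smul, map_sub, smul_eq_mul]
          field_simp
          ring
      have hr : p + θ • (a - p) ∈ C ∩ {y | l y = c} :=
        ⟨hC.add_smul_sub_mem hp haC ⟨hθ0, hθ1.le⟩, hlr⟩
      have h1 := vsub_mem_vectorSpan ℝ hr (show q ∈ C ∩ {y | l y = c} from ⟨hqC, hlq⟩)
      rw [vsub_eq_sub, ← hπker (p + θ • (a - p) - q) (by rw [map_sub, hlr, hlq, sub_self])] at h1
      have h2 : p + θ • (a - p) - q = (1 - θ) • (p - q) + θ • (a - q) := by module
      rw [h2, map_add, map_smul, map_smul, hπseg a ha, smul_zero, add_zero] at h1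
      have h3 := Submodule.smul_mem _ (1 - θ)⁻¹ h1
      rwa [inv_smul_smul₀ (by linarith)] at h3
    rintro d ⟨hd, hld⟩
    have hle : vectorSpan ℝ C ≤ (vectorSpan ℝ (C ∩ {y | l y = c})).comap π := by
      rw [vectorSpan_eq_span_vsub_set_right ℝ hqC, Submodule.span_le]
      rintro _ ⟨p, hp, rfl⟩
      exact hmain p hp
    rw [← hπker d hld]
    exact hle hd

theorem finrank_inf_ker_add_one {V : Submodule ℝ E} [FiniteDimensional ℝ V] (g : E →ₗ[ℝ] ℝ) {d : E}
    (hd : d ∈ V) (hgd : g d ≠ 0) :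
    Module.finrank ℝ (V ⊓ g.ker : Submodule ℝ E) + 1 = Module.finrank ℝ V := by
  have hne : g.domRestrict V ≠ 0 := by
    intro h
    exact hgd (LinearMap.congr_fun h ⟨d, hd⟩)
  rw [← Module.Dual.finrank_ker_add_one_of_ne_zero (f := g.domRestrict V) hne]
  rw [← Submodule.map_comap_subtype, Submodule.finrank_map_subtype_eq, LinearMap.ker_domRestrict]

theorem dim_inter_hyperplane [FiniteDimensional ℝ E] {C : Set E} (hC : Convex ℝ C) {x w : E}
    (hx : x ∈ C) (hw : w ∈ C) (hlx : l x < c) (hlw : c < l w) :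
    dim (C ∩ {y | l y = c}) = dim C - 1 := by
  obtain ⟨q, hq, hlq⟩ := exists_mem_segment_of_lt hlx hlw
  have h1 : C ≠ ∅ := Set.nonempty_iff_ne_empty.1 ⟨w, hw⟩
  have h2 : C ∩ {y | l y = c} ≠ ∅ :=
    Set.nonempty_iff_ne_empty.1 ⟨q, hC.segment_subset hx hw hq, hlq⟩
  rw [dim, dim, if_neg h1, if_neg h2, vectorSpan_inter_hyperplane hC hx hw hlx hlw,
    ← finrank_inf_ker_add_one l.toLinearMap (vsub_mem_vectorSpan ℝ hw hx)
      (by simpa [sub_eq_zero] using (hlx.trans hlw).ne')]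
  push_cast
  ring

theorem isFace_hyperplane : IsFace (P ∩ {y | c ≤ l y}) (P ∩ {y | l y = c}) := by
  refine isFace_of_forall_le (-l) (-c) (fun p hp => by simpa using hp.2) ?_
  ext p
  simp only [Set.mem_inter_iff, Set.mem_ofPred_eq, neg_apply, neg_inj]
  exact ⟨fun ⟨h1, h2⟩ => ⟨⟨h1, h2.ge⟩, h2⟩, fun ⟨⟨h1, _⟩, h2⟩ => ⟨h1, h2⟩⟩

/-- For uniqueness, another such facet lies in the section and has the same dimension, hence the
same direction space. Its exposing functional is then constant on the section. -/
theorem isTruncationFacet [FiniteDimensional ℝ E] (hP : Convex ℝ P) {x w : E} (hx : x ∈ P)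
    (hw : w ∈ P) (hlx : l x < c) (hlw : c < l w) :
    IsTruncationFacet P {y | c ≤ l y} (P ∩ {y | l y = c}) := by
  have hl : l ≠ 0 := by
    rintro rfl
    simp only [zero_apply] at hlx hlw
    linarith
  have hdim : dim (P ∩ {y | l y = c}) = dim (P ∩ {y | c ≤ l y}) - 1 := by
    rw [dim_inter_hyperplane hP hx hw hlx hlw, dim_inter_halfspace hP hw hlw]
  obtain ⟨q, hq, hlq⟩ := exists_mem_segment_of_lt hlx hlw
  have hF : P ∩ {y | l y = c} ≠ ∅ :=
    Set.nonempty_iff_ne_empty.1 ⟨q, hP.segment_subset hx hw hq, hlq⟩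
  rw [IsTruncationFacet, frontier_halfspace hl]
  refine ⟨⟨⟨isFace_hyperplane, hdim⟩, Set.inter_subset_right⟩, fun G hG hGf => ?_⟩
  have hGF : G ⊆ P ∩ {y | l y = c} := fun g hg => ⟨(IsExposed.subset hG.1 hg).1, hGf hg⟩
  have hGdim := hG.2
  rw [← hdim, dim, dim, if_neg hF] at hGdim
  have hGne : G ≠ ∅ := by
    -- The empty set has dimension `-1`, which is no `finrank`.
    intro h
    rw [if_pos h] at hGdim
    omega
  rw [if_neg hGne] at hGdim
  have hspan := Submodule.eq_of_le_of_finrank_eq (vectorSpan_mono ℝ hGF)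
    (by exact_mod_cast hGdim)
  obtain ⟨g, hg⟩ := Set.nonempty_iff_ne_empty.2 hGne
  obtain ⟨m, rfl⟩ := hG.1 ⟨g, hg⟩
  refine hGF.antisymm fun y hy => ?_
  have hle : vectorSpan ℝ (P ∩ {y | l y = c}) ≤ m.toLinearMap.ker := by
    rw [← hspan, vectorSpan_eq_span_vsub_set_right ℝ hg, Submodule.span_le]
    rintro _ ⟨p, hp, rfl⟩
    simpa [sub_eq_zero] using (hg.2 p hp.1).antisymm (hp.2 g hg.1)
  have hmy : m y = m g := by
    simpa [sub_eq_zero] using hle (vsub_mem_vectorSpan ℝ hy (hGF hg))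
  exact ⟨⟨hy.1, hy.2.ge⟩, fun z hz => hmy ▸ hg.2 z hz⟩

/-- An edge of `P` crossed by the boundary of the half-space is shortened by the truncation. -/
theorem exists_edge_truncation (hP : Convex ℝ P) {e : Set E} (he : IsEdge P e) {x w : E}
    (hx : x ∈ e) (hw : w ∈ e) (hlx : l x < c) (hlw : c < l w) {v : E} (hv : v ∈ segment ℝ x w)
    (hlv : l v = c) : v ∈ vertices (P ∩ {y | c ≤ l y}) ∧
      ∃ e', IsEdge (P ∩ {y | c ≤ l y}) e' ∧ v ∈ e' ∧ w ∈ e' := by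
  have heP : e ⊆ P := IsExposed.subset he.1
  have heconv : Convex ℝ e := IsExposed.convex he.1 hP
  have hve : v ∈ e := heconv.segment_subset hx hw hv
  have hface : IsFace (P ∩ {y | c ≤ l y}) (e ∩ {y | c ≤ l y}) := by
    rintro ⟨z, hz⟩
    obtain ⟨m, rfl⟩ := he.1 ⟨w, hw⟩
    refine ⟨m, ?_⟩
    ext p
    exact ⟨fun hp => ⟨⟨hp.1.1, hp.2⟩, fun y hy => hp.1.2 y hy.1⟩,
      fun hp => ⟨⟨hp.1.1, fun y hy => (hw.2 y hy).trans (hp.2 w ⟨hw.1, hlw.le⟩)⟩, hp.1.2⟩⟩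
  refine ⟨?_, e ∩ {y | c ≤ l y}, ⟨hface, ?_⟩, ⟨hve, hlv.ge⟩, hw, hlw.le⟩
  -- The point `v` is where two faces meet, because `l` is injective on the line of the edge.
  · have h := IsExposed.inter hface (isFace_hyperplane (P := P) (l := l) (c := c))
    have heq : (e ∩ {y | c ≤ l y}) ∩ (P ∩ {y | l y = c}) = {v} := by
      ext p
      constructor
      · rintro ⟨⟨hpe, -⟩, -, hlp⟩
        have hxw : x ≠ w := by
          rintro rfl
          linarith
        obtain ⟨k, hk⟩ := exists_smul_of_dim_eq_one he.2 hx hw hxw (vsub_mem_vectorSpan ℝ hpe hve)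
        have h0 : k * (l w - l x) = 0 := by
          have := congrArg l hk
          rw [map_smul, map_sub, vsub_eq_sub, map_sub, smul_eq_mul, hlp, hlv, sub_self] at this
          exact this.symm
        have hk0 : k = 0 := (mul_eq_zero.1 h0).resolve_right (by linarith)
        rw [hk0, zero_smul, vsub_eq_sub, sub_eq_zero] at hk
        exact hk
      · rintro rfl
        exact ⟨⟨hve, hlv.ge⟩, heP hve, hlv⟩
    rw [heq] at h
    exact h
  · rw [dim_inter_halfspace heconv hw hlw, he.2]

/-- Edges of the truncated polytope through a point in the interior of the half-space extend to
edges of the polytope. -/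
theorem exists_edge_extension (hP : Convex ℝ P) {e : Set E} {w : E}
    (he : IsEdge (P ∩ {y | c ≤ l y}) e) (hw : w ∈ e) (hlw : c < l w) :
    ∃ e', IsEdge P e' ∧ e ⊆ e' := by
  obtain ⟨m, rfl⟩ := he.1 ⟨w, hw⟩
  -- Near `w` the truncation agrees with `P` along segments, and a local maximum of a linear
  -- functional on a convex set is global.
  have hmax : ∀ y ∈ P, m y ≤ m w := by
    intro y hy
    by_contra! hlt
    have hpos : 0 < |l (y - w)| + 1 := by positivity
    have hε : 0 < min 1 ((l w - c) / (|l (y - w)| + 1)) :=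
      lt_min one_pos (div_pos (sub_pos.2 hlw) hpos)
    set ε := min 1 ((l w - c) / (|l (y - w)| + 1))
    have hε1 : ε ≤ 1 := min_le_left _ _
    have hε2 : ε * (|l (y - w)| + 1) ≤ l w - c := (le_div_iff₀ hpos).1 (min_le_right _ _)
    have := hw.2 (w + ε • (y - w)) ⟨hP.add_smul_sub_mem hw.1.1 hy ⟨hε.le, hε1⟩, by
      simp only [Set.mem_ofPred_eq, map_add, map_smul, smul_eq_mul]
      nlinarith [neg_abs_le (l (y - w))]⟩
    simp only [map_add, map_smul, map_sub, smul_eq_mul] at this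
    nlinarith
  have hface : IsFace P {p ∈ P | m p = m w} := isFace_of_forall_le m (m w) hmax rfl
  have heq : {p ∈ P | m p = m w} ∩ {y | c ≤ l y} =
      {p ∈ P ∩ {y | c ≤ l y} | ∀ y ∈ P ∩ {y | c ≤ l y}, m y ≤ m p} := by
    ext p
    exact ⟨fun hp => ⟨⟨hp.1.1, hp.2⟩, fun y hy => (hmax y hy.1).trans hp.1.2.ge⟩,
      fun hp => ⟨⟨hp.1.1, (hmax p hp.1.1).antisymm (hp.2 w hw.1)⟩, hp.1.2⟩⟩
  refine ⟨{p ∈ P | m p = m w}, ⟨hface, ?_⟩, heq ▸ Set.inter_subset_left⟩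
  rw [← dim_inter_halfspace (IsExposed.convex hface hP)
    (show w ∈ {p ∈ P | m p = m w} from ⟨hw.1.1, rfl⟩) hlw, heq]
  exact he.2

/-- By `hc` the point `v` is not a vertex of `P`, so it is interior to the edge of `P` that extends
`e`. `GeneratesAt.truncate` then gives `dim P` generators at `v`. -/
theorem simpleAt_of_mem_edge [FiniteDimensional ℝ E] (hP : IsPolytope P)
    (hc : ∀ u ∈ vertices P, l u ≠ c) {w : vertices P} (hlw : c < l w) (hw : SimpleAt P w)
    {e : Set E} (he : IsEdge (P ∩ {y | c ≤ l y}) e) (hwe : (w : E) ∈ e)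
    (v : vertices (P ∩ {y | c ≤ l y})) (hve : (v : E) ∈ e) (hlv : l v = c) :
    SimpleAt (P ∩ {y | c ≤ l y}) v := by
  classical
  obtain ⟨w, hwP⟩ := w
  obtain ⟨v, hv⟩ := v
  dsimp only at hlw hwe hve hlv
  obtain ⟨e', he', hee'⟩ := exists_edge_extension hP.convex he hwe hlw
  obtain ⟨B, f, hgen, hf, hirr⟩ := hP.exists_generatesAt hwP
  obtain ⟨u, τ, hu, -, hN⟩ := hgen.exists_neighborSet_eq hP hwP hf hirr
  rw [SimpleAt, hN, ncard_range_of_injective hu] at hw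
  have hwP' : w ∈ P := IsExposed.subset hwP rfl
  have hvP : v ∈ P := (IsExposed.subset hv rfl).1
  have hwv : w ≠ v := by
    rintro rfl
    linarith
  obtain ⟨i, t, ht, hvt⟩ := hgen.exists_of_isEdge hf he' (hee' hwe) (hee' hve) hwv
  have hli : l ((i : E) - w) < 0 := by
    have := congrArg l hvt
    rw [map_add, map_smul, smul_eq_mul, hlv] at this
    by_contra! h
    nlinarith [mul_nonneg ht.le h]
  have hray : v ∈ ray P w ((i : E) - w) := ⟨hvP, t, ht.le, hvt⟩
  have hnotext : v ∉ P.extremePoints ℝ := fun h => hc v (hP.vertices_eq ▸ h) hlv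
  -- Otherwise `v` ends the ray, where `-l` is greatest, and would be extreme in `P`.
  obtain ⟨t', htt', ht'⟩ : ∃ t', t < t' ∧ w + t' • ((i : E) - w) ∈ P := by
    by_contra! hmax
    apply hnotext
    refine (IsExposed.isExtreme (hgen.isFace_ray hf hirr i)).extremePoints_subset_extremePoints ?_
    refine isExtreme_singleton.1 (IsExposed.isExtreme (mem_exposedPoints_iff_exposed_singleton.1
      ⟨hray, -l, ?_⟩))
    rintro _ ⟨hyP, r, hr, rfl⟩
    have hrt : r ≤ t := not_lt.1 fun h => hmax r h hyP
    rw [hvt]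
    simp only [neg_apply, map_add, map_smul, smul_eq_mul]
    refine ⟨by nlinarith, fun h' => ?_⟩
    have : r = t := le_antisymm hrt (by nlinarith)
    rw [this]
  have hgen' := hgen.truncate hP.convex hwP' hli ht htt' ht'
  rw [← hvt, hlv] at hgen'
  exact hgen'.simpleAt (hP.inter_halfspace l c) hv
    (by rw [hw, dim_inter_halfspace hP.convex hwP' hlw])

end Polytope

/-! ### Truncation at a vertex, and the main theorem. -/

namespace Polytope

variable {E : Type*} [NormedAddCommGroup E] [NormedSpace ℝ E]
variable {P : Set E} {l : StrongDual ℝ E} {c : ℝ}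

/-- A truncating half-space is given by a functional that separates the vertices of `P` in `T`
strictly from the other ones. -/
theorem IsTruncating.exists_functional {T H : Set E} (h : IsTruncating P T H) (hT : IsFace P T) :
    ∃ (l : StrongDual ℝ E) (c : ℝ), H = {y | c ≤ l y} ∧
      (∀ u ∈ vertices P, u ∈ T → l u < c) ∧ ∀ u ∈ vertices P, u ∉ T → c < l u := by
  obtain ⟨l, hl, c, rfl⟩ := h.isHalfspace
  refine ⟨l, c, rfl, fun u hu huT => ?_, fun u hu huT => ?_⟩
  · exact not_le.1 (h.notMem_of_mem_vertices u
      (IsExposed.mono hu (IsExposed.subset hT) (Set.singleton_subset_iff.2 huT)))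
  · have := h.mem_interior u hu huT
    rwa [interior_halfspace hl] at this

/-- A vertex of the truncation at the vertex `x` that lies on the cutting hyperplane lies on an edge
of `P` through `x`. -/
theorem exists_adj_mem_segment (hP : IsPolytope P) (x : vertices P)
    (hlx : l x < c) (hl : ∀ u ∈ vertices P, u ≠ x → c < l u) {v : E}
    (hv : v ∈ vertices (P ∩ {y | c ≤ l y})) (hlv : l v = c) :
    ∃ u : vertices P, (graph P).Adj x u ∧ v ∈ segment ℝ (x : E) u := by
  obtain ⟨x, hx⟩ := x
  dsimp only at hlx hl ⊢
  obtain ⟨B, f, hgen, hf, hirr⟩ := hP.exists_generatesAt hx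
  obtain ⟨u, τ, -, hu, hN⟩ := hgen.exists_neighborSet_eq hP hx hf hirr
  have hadj : ∀ i, (graph P).Adj ⟨x, hx⟩ (u i) := fun i => by
    rw [← SimpleGraph.mem_neighborSet, hN]
    exact ⟨i, rfl⟩
  have hlu : ∀ i, c < l (u i) := fun i =>
    hl _ (u i).2 fun h => (hadj i).ne (Subtype.ext h.symm)
  have hxP : x ∈ P := IsExposed.subset hx rfl
  choose q hq hlq using fun i => exists_mem_segment_of_lt hlx (hlu i)
  have hqP : ∀ i, q i ∈ P ∩ {y | c ≤ l y} := fun i =>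
    ⟨hP.convex.segment_subset hxP (IsExposed.subset (u i).2 rfl) (hq i), (hlq i).ge⟩
  have hqb : ∀ i, ∃ k : ℝ, 0 < k ∧ q i - x = k • ((i : E) - x) := by
    intro i
    have hi := hq i
    rw [segment_eq_image'] at hi
    obtain ⟨θ, hθ, hθq⟩ := hi
    simp only [(hu i).2, add_sub_cancel_left, smul_smul] at hθq
    have hθ0 : θ ≠ 0 := by
      rintro rfl
      rw [zero_mul, zero_smul, add_zero] at hθq
      have := hlq i
      rw [← hθq] at this
      linarith
    exact ⟨θ * τ i, mul_pos (lt_of_le_of_ne hθ.1 hθ0.symm) (hu i).1, by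
      rw [← hθq, add_sub_cancel_left]⟩
  choose k hk hqk using hqb
  obtain ⟨s, hs, hvs⟩ := hgen.exists_coeff v (IsExposed.subset hv rfl).1
  have hvq : v - x = ∑ i, (s i / k i) • (q i - x) := by
    rw [hvs]
    refine Finset.sum_congr rfl fun i _ => ?_
    rw [hqk, smul_smul, div_mul_cancel₀ _ (hk i).ne']
  -- Both `v - x` and every `q i - x` have `l`-value `c - l x`, which is nonzero.
  have hsum : ∑ i, s i / k i = 1 := by
    have h1 := congrArg l hvq
    simp only [map_sub, map_sum, map_smul, smul_eq_mul, hlq, hlv, ← Finset.sum_mul] at h1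
    exact mul_right_cancel₀ (b := c - l x) (by linarith) (by rw [one_mul, ← h1])
  have hmem : v ∈ convexHull ℝ (Set.range q) := by
    have : v = ∑ i, (s i / k i) • q i := by
      simp only [smul_sub, Finset.sum_sub_distrib, ← Finset.sum_smul, hsum, one_smul] at hvq
      exact sub_left_injective hvq
    rw [this]
    exact (convex_convexHull ℝ _).sum_mem (fun i _ => div_nonneg (hs i) (hk i).le) hsum
      fun i _ => subset_convexHull ℝ _ ⟨i, rfl⟩
  have hP' := hP.inter_halfspace l c
  have hsub : convexHull ℝ (Set.range q) ⊆ P ∩ {y | c ≤ l y} :=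
    convexHull_min (Set.range_subset_iff.2 hqP) hP'.convex
  -- An extreme point of the truncation lying in the hull of the `q i` is one of them.
  obtain ⟨i, rfl⟩ := extremePoints_convexHull_subset
    (inter_extremePoints_subset_extremePoints_of_subset hsub ⟨hmem, hP'.vertices_eq ▸ hv⟩)
  exact ⟨u i, hadj i, hq i⟩

/-- This puts a point of `P` strictly beyond the cut, as `isTruncationFacet` requires. -/
theorem exists_vertex_ne (hP : IsPolytope P) (hdim : 1 ≤ dim P) (x : E) :
    ∃ u ∈ vertices P, u ≠ x := by
  by_contra! h
  have hsub : P ⊆ {x} := by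
    rw [← hP.convexHull_vertices]
    exact convexHull_min h (convex_singleton x)
  have hspan : vectorSpan ℝ P = ⊥ := vectorSpan_of_subsingleton ℝ
    (Set.subsingleton_singleton.anti hsub)
  rw [dim, hspan] at hdim
  split_ifs at hdim
  · omega
  · simp at hdim

theorem mem_vertices_inter {H : Set E} {w : E} (hw : w ∈ vertices P) (hwH : w ∈ H) :
    w ∈ vertices (P ∩ H) :=
  IsExposed.inter_left hw (Set.singleton_subset_iff.2 hwH)

end Polytope

theorem mainTheorem6 (n : ℕ) (P : Set (EuclideanSpace ℝ (Fin n)))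
    (hP : Polytope.IsPolytope P) :
    -- the lemma: truncation at a face `T` that contains `x` but not its neighbour `w`
    (∀ (x w : Polytope.vertices P) (T H : Set (EuclideanSpace ℝ (Fin n))),
      Polytope.IsFace P T → (x : EuclideanSpace ℝ (Fin n)) ∈ T →
      (Polytope.graph P).Adj x w → (w : EuclideanSpace ℝ (Fin n)) ∉ T →
      Polytope.IsTruncating P T H →
      Polytope.IsPolytope (P ∩ H) ∧
      ∃ F, Polytope.IsTruncationFacet P H F ∧
        ∃ hw : (w : EuclideanSpace ℝ (Fin n)) ∈ Polytope.vertices (P ∩ H),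
          (∃! v : Polytope.vertices (P ∩ H),
            (v : EuclideanSpace ℝ (Fin n)) ∈ F ∧
            (v : EuclideanSpace ℝ (Fin n)) ∈
              segment ℝ (x : EuclideanSpace ℝ (Fin n)) (w : EuclideanSpace ℝ (Fin n)) ∧
            (Polytope.graph (P ∩ H)).Adj v ⟨w, hw⟩) ∧
          (Polytope.SimpleAt P w →
            ∀ v : Polytope.vertices (P ∩ H), (v : EuclideanSpace ℝ (Fin n)) ∈ F →
              (Polytope.graph (P ∩ H)).Adj v ⟨w, hw⟩ → Polytope.SimpleAt (P ∩ H) v)) ∧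
    -- the corollary: truncation at a vertex `x` all of whose neighbours are simple
    (∀ (x : Polytope.vertices P) (H : Set (EuclideanSpace ℝ (Fin n))),
      1 ≤ Polytope.dim P →
      Polytope.IsTruncating P {(x : EuclideanSpace ℝ (Fin n))} H →
      (∀ w : Polytope.vertices P, (Polytope.graph P).Adj x w → Polytope.SimpleAt P w) →
      Polytope.IsPolytope (P ∩ H) ∧
      ∃ F, Polytope.IsTruncationFacet P H F ∧
        ∀ v : Polytope.vertices (P ∩ H), (v : EuclideanSpace ℝ (Fin n)) ∈ F →
          Polytope.SimpleAt (P ∩ H) v) := by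
  refine ⟨fun x w T H hT hxT hxw hwT hH => ?_, fun x H hdim hH hx => ?_⟩
  · obtain ⟨l, c, rfl, hlT, hlT'⟩ := hH.exists_functional hT
    have hlx := hlT x x.2 hxT
    have hlw := hlT' w w.2 hwT
    have hc : ∀ u ∈ Polytope.vertices P, l u ≠ c := fun u hu => by
      by_cases h : u ∈ T
      · exact (hlT u hu h).ne
      · exact (hlT' u hu h).ne'
    have hxP := IsExposed.subset x.2 rfl
    have hwP := IsExposed.subset w.2 rfl
    refine ⟨hP.inter_halfspace l c, _, Polytope.isTruncationFacet hP.convex hxP hwP hlx hlw,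
      Polytope.mem_vertices_inter w.2 hlw.le, ?_, ?_⟩
    · obtain ⟨-, e, he, hxe, hwe⟩ := hxw
      obtain ⟨v, hv, hlv⟩ := Polytope.exists_mem_segment_of_lt hlx hlw
      obtain ⟨hvP, e', he', hve', hwe'⟩ :=
        Polytope.exists_edge_truncation hP.convex he hxe hwe hlx hlw hv hlv
      refine ⟨⟨v, hvP⟩, ⟨⟨(IsExposed.subset hvP rfl).1, hlv⟩, hv, ?_, e', he', hve', hwe'⟩, ?_⟩
      · intro h
        have hvw : v = w := congrArg Subtype.val h
        rw [← hvw, hlv] at hlw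
        exact lt_irrefl _ hlw
      · rintro ⟨y, hy⟩ ⟨hyF, hys, -⟩
        exact Subtype.ext (Polytope.eq_of_mem_segment (hlx.trans hlw).ne hys hv
          (hyF.2.trans hlv.symm))
    · rintro hw v hvF ⟨-, e, he, hve, hwe⟩
      exact Polytope.simpleAt_of_mem_edge hP hc hlw hw he hwe v hve hvF.2
  · obtain ⟨l, c, rfl, hlT, hlT'⟩ := hH.exists_functional x.2
    have hlx := hlT x x.2 rfl
    have hc : ∀ u ∈ Polytope.vertices P, l u ≠ c := fun u hu => by
      by_cases h : u ∈ ({(x : EuclideanSpace ℝ (Fin n))} : Set _)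
      · exact (hlT u hu h).ne
      · exact (hlT' u hu h).ne'
    obtain ⟨w, hw, hwx⟩ := Polytope.exists_vertex_ne hP hdim x
    refine ⟨hP.inter_halfspace l c, _, Polytope.isTruncationFacet hP.convex
      (IsExposed.subset x.2 rfl) (IsExposed.subset hw rfl) hlx (hlT' w hw hwx), ?_⟩
    rintro v ⟨-, hlv⟩
    obtain ⟨u, hxu, hv⟩ := Polytope.exists_adj_mem_segment hP x hlx hlT' v.2 hlv
    have hlu := hlT' u u.2 fun h => hxu.ne (Subtype.ext (Set.mem_singleton_iff.1 h).symm)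
    obtain ⟨-, e, he, hxe, hue⟩ := id hxu
    -- The shortened edge joins `v` to the simple neighbour `u` of `x`.
    obtain ⟨-, e', he', hve', hue'⟩ :=
      Polytope.exists_edge_truncation hP.convex he hxe hue hlx hlu hv hlv
    exact Polytope.simpleAt_of_mem_edge hP hc hlu (hx u hxu) he' hue' v hve' hlv
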